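/- Let $D$ be an oriented knot diagram with $N\ge 1$ crossings. Label its arcs $0,\dots,N-1$ (indices mod $N$) along the orientation and its crossings so that arc $n$ ends, and arc $n+1$ starts, by passing under crossing $n$; let $k(n)$ be the arc passing over at crossing $n$ and $\sigma_n=\pm1$ the sign of the crossing. Let $G$ be the knot group with its Wirtinger presentation: generators $m_0,\dots,m_{N-1}$ and relations $m_{n+1}=m_{k(n)}^{-\sigma_n}m_n m_{k(n)}^{\sigma_n}$. For $v=\binom{x}{y}\in\mathbb C^2$ put $$M(v)=\begin{pmatrix}1-xy & x^2\\ -y^2 & 1+xy\end{pmatrix}\in SL(2,\mathbb C).$$ For $\varepsilon=(\varepsilon_0,\dots,\varepsilon_{N-1})\in\{\pm1\}^N$, vectors $a_0,\dots,a_{N-1}\in\mathbb C^2$ form an arc-coloring of sign-type $\varepsilon$ if $\varepsilon_n a_{n+1}=M(a_{k(n)})^{-\sigma_n}a_n$ for all $n$. The associated representation is $\rho_a:G\to SL(2,\mathbb C)$, $m_n\mapsto M(a_n)$. Let $p:SL(2,\mathbb C)\to PSL(2,\mathbb C)$ be the projection. A representation $\tau:G\to SL(2,\mathbb C)$ is called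 boundary-unipotent if $\operatorname{tr}\tau(\gamma)=2$ for every $\gamma$ in every peripheral subgroup (generated by a meridian $m_i$ and the longitude based at arc $i$). The obstruction class of a representation $G\to PSL(2,\mathbb C)$ is the element of $\{\pm1\}$ which is $+1$ if and only if the representation lifts to a boundary-unipotent $SL(2,\mathbb C)$-representation, and the obstruction class of $\rho_a$ is that of $p\circ\rho_a$. The longitude with framing $f\in\mathbb Z$ based at arc $i$ is $$\lambda_{i,f}=m_{k(i)}^{\sigma_i}m_{k(i+1)}^{\sigma_{i+1}}\cdots m_{k(i+N-1)}^{\sigma_{i+N-1}}\; m_i^{\,f-\sum_n\sigma_n}.$$ Theorem. Let $a$ be an arc-coloring of $D$ of sign-type $\varepsilon$ such that $\rho_a$ is not the trivial representation (in particular, $\rho_a$ may be any non-abelian parabolic representation arising from a coloring). Then the obstruction class of $\rho_a$ equals the total sign $\varepsilon_0\varepsilon_1\cdots\varepsilon_{N-1}$. Moreover it is half the trace of a longitude: $\operatorname{tr}\rho_a(\lambda_{i,f})=2\,\varepsilon_0\cdots\varepsilon_{N-1}$ for every longitude $\lambda_{i,f}$, and $\operatorname{tr}\tau(\lambda_{i,0})=2\,\varepsilon_0\cdots\varepsilon_{N-1}$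 for every $i$ and every lift $\tau:G\to SL(2,\mathbb C)$ of $p\circ\rho_a$. In particular $\rho_a$ is boundary-unipotent if and only if $\varepsilon_0\cdots\varepsilon_{N-1}=1$. -/

import Mathlib

open Matrix

/-- Oriented signed Gauss code of a closed curve with `N ≥ 1` crossings, cut at its
under-passages into the arcs `0, …, N - 1`.  Indices are cyclic and compatible with the
orientation: arc `i` ends (by passing under) at crossing `i`, and arc `i + 1` starts there.
`overArc c` is the over-strand at crossing `c`, `overList i` lists, in the order of the
orientation, the crossings which arc `i` passes over, and `sign c` is the sign of crossing `c`. -/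
structure GaussCode (N : ℕ) [NeZero N] where
  overArc : Fin N → Fin N
  overList : Fin N → List (Fin N)
  sign : Fin N → ℤˣ
  nodup_overList : ∀ i, (overList i).Nodup
  mem_overList : ∀ c i, c ∈ overList i ↔ overArc c = i

namespace GaussCode

/-- The two passages through a crossing: over or under. -/
inductive Level
  | over
  | under
deriving DecidableEq

/-- The half-edges at a passage: the incoming and the outgoing one. -/
inductive Dir
  | inc
  | out
deriving DecidableEq

variable {N : ℕ} [NeZero N]

/-- The cyclic sequence of all `2N` passages met along the curve. -/
def passages (D : GaussCode N) : List (Fin N × Level) :=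
  (List.finRange N).flatMap fun i =>
    (D.overList i).map (fun c => (c, Level.over)) ++ [(i, Level.under)]

/-- The next passage along the curve. -/
def next (D : GaussCode N) : Equiv.Perm (Fin N × Level) := D.passages.formPerm

/-- The other half of the edge containing a given half-edge. -/
def otherHalf (D : GaussCode N) : (Fin N × Level) × Dir → (Fin N × Level) × Dir
  | (p, Dir.out) => (D.next p, Dir.inc)
  | (p, Dir.inc) => (D.next⁻¹ p, Dir.out)

/-- The next half-edge counterclockwise around a crossing.  At a positive crossing the cyclic
order is over-out, under-out, over-in, under-in (turning the over-strand counterclockwise gives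
the under-strand); at a negative crossing it is over-out, under-in, over-in, under-out. -/
def rotate (D : GaussCode N) : (Fin N × Level) × Dir → (Fin N × Level) × Dir
  | ((c, Level.over), Dir.out) =>
      if D.sign c = 1 then ((c, Level.under), Dir.out) else ((c, Level.under), Dir.inc)
  | ((c, Level.over), Dir.inc) =>
      if D.sign c = 1 then ((c, Level.under), Dir.inc) else ((c, Level.under), Dir.out)
  | ((c, Level.under), Dir.out) =>
      if D.sign c = 1 then ((c, Level.over), Dir.inc) else ((c, Level.over), Dir.out)
  | ((c, Level.under), Dir.inc) =>
      if D.sign c = 1 then ((c, Level.over), Dir.out) else ((c, Level.over), Dir.inc)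

/-- The regions of the surface carrying the code: the orbits of half-edges under walking along
the boundary of a region. -/
def Face (D : GaussCode N) : Type :=
  Quot fun h h' : (Fin N × Level) × Dir => h' = D.rotate (D.otherHalf h)

/-- The surface carrying the code is a sphere: `V - E + F = N - 2N + F = 2`. -/
def IsPlanar (D : GaussCode N) : Prop := Nat.card D.Face = N + 2

end GaussCode

/-- An oriented knot diagram (on the sphere, up to isotopy) with `N ≥ 1` crossings. -/
structure KnotDiagram (N : ℕ) [NeZero N] extends GaussCode N where
  planar : toGaussCode.IsPlanar

section Quandle

/-- The parabolic quandle map, sending a vector `(x, y)` to a matrix of trace `2`. -/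
def quandleMap (a : Fin 2 → ℂ) : Matrix.SpecialLinearGroup (Fin 2) ℂ :=
  ⟨!![1 - a 0 * a 1, a 0 ^ 2; -a 1 ^ 2, 1 + a 0 * a 1], by rw [det_fin_two_of]; ring⟩

/-- `a ▷ b = M(b)⁻¹ a`. -/
noncomputable def qr (a b : Fin 2 → ℂ) : Fin 2 → ℂ :=
  (((quandleMap b)⁻¹ : Matrix.SpecialLinearGroup (Fin 2) ℂ) : Matrix (Fin 2) (Fin 2) ℂ) *ᵥ a

/-- `a ◁ b = M(b) a`. -/
noncomputable def ql (a b : Fin 2 → ℂ) : Fin 2 → ℂ := (quandleMap b : Matrix (Fin 2) (Fin 2) ℂ) *ᵥ a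

theorem quandleMap_mulVec (A : Matrix.SpecialLinearGroup (Fin 2) ℂ) (b : Fin 2 → ℂ) :
    quandleMap ((A : Matrix (Fin 2) (Fin 2) ℂ) *ᵥ b) = A * quandleMap b * A⁻¹ := by
  have hA : A 0 0 * A 1 1 - A 0 1 * A 1 0 = 1 := by
    rw [← det_fin_two]; exact A.det_coe
  rw [eq_mul_inv_iff_mul_eq]
  apply Matrix.SpecialLinearGroup.ext
  intro i j
  change ((quandleMap ((A : Matrix (Fin 2) (Fin 2) ℂ) *ᵥ b) : Matrix (Fin 2) (Fin 2) ℂ) *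
    (A : Matrix (Fin 2) (Fin 2) ℂ)) i j =
    ((A : Matrix (Fin 2) (Fin 2) ℂ) * (quandleMap b : Matrix (Fin 2) (Fin 2) ℂ)) i j
  fin_cases i <;> fin_cases j <;>
    simp [quandleMap, Matrix.mul_apply, Matrix.mulVec, dotProduct, Fin.sum_univ_two]
  · linear_combination (-(A 0 0 * b 0 + A 0 1 * b 1) * b 1) * hA
  · linear_combination ((A 0 0 * b 0 + A 0 1 * b 1) * b 0) * hA
  · linear_combination (-(A 1 0 * b 0 + A 1 1 * b 1) * b 1) * hA
  · linear_combination ((A 1 0 * b 0 + A 1 1 * b 1) * b 0) * hA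

theorem quandleMap_sign_smul (e : ℤˣ) (a : Fin 2 → ℂ) :
    quandleMap (((e : ℤ) : ℂ) • a) = quandleMap a := by
  rcases Int.units_eq_one_or e with rfl | rfl <;>
    · ext i j
      fin_cases i <;> fin_cases j <;> simp [quandleMap]

end Quandle

namespace KnotDiagram

variable {N : ℕ} [NeZero N]

/-- The Wirtinger relator at crossing `c`, with under-strands `i = c` (incoming) and `j = c + 1`
(outgoing) and over-strand `k`: `m_j⁻¹ m_k⁻¹ m_i m_k` at a positive crossing and
`m_j⁻¹ m_k m_i m_k⁻¹` at a negative one. -/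
def relator (D : KnotDiagram N) (c : Fin N) : FreeGroup (Fin N) :=
  if D.sign c = 1 then
    (FreeGroup.of (c + 1))⁻¹ * (FreeGroup.of (D.overArc c))⁻¹ * FreeGroup.of c *
      FreeGroup.of (D.overArc c)
  else
    (FreeGroup.of (c + 1))⁻¹ * FreeGroup.of (D.overArc c) * FreeGroup.of c *
      (FreeGroup.of (D.overArc c))⁻¹

/-- The knot group, by the Wirtinger presentation of the diagram. -/
abbrev knotGroup (D : KnotDiagram N) : Type := PresentedGroup (Set.range D.relator)

/-- The Wirtinger generator (meridian) of arc `i`. -/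
def meridian (D : KnotDiagram N) (i : Fin N) : D.knotGroup := PresentedGroup.of i

/-- The sum of the crossing signs. -/
def writhe (D : KnotDiagram N) : ℤ := ∑ c, (D.sign c : ℤ)

/-- The blackboard-framed longitude based at arc `i`: going once around the knot parallel to the
diagram, record the over-strand `k` of each under-crossing met (these are `i, i + 1, …` in cyclic
order), as `m_k` or `m_k⁻¹` according to the sign of the crossing. -/
def blackboardLongitude (D : KnotDiagram N) (i : Fin N) : D.knotGroup :=
  (List.ofFn fun t : Fin N => D.meridian (D.overArc (i + t)) ^ (D.sign (i + t) : ℤ)).prod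

/-- The longitude based at arc `i` with framing (linking number with the knot) `f`. -/
def longitude (D : KnotDiagram N) (i : Fin N) (f : ℤ) : D.knotGroup :=
  D.blackboardLongitude i * D.meridian i ^ (f - D.writhe)

/-- The peripheral subgroup based at arc `i`: the fundamental group of the boundary torus. -/
def peripheral (D : KnotDiagram N) (i : Fin N) : Subgroup D.knotGroup :=
  Subgroup.closure {D.meridian i, D.longitude i 0}

/-- All loops on the boundary torus have trace `2`. -/
def IsBoundaryUnipotent (D : KnotDiagram N)
    (ρ : D.knotGroup →* Matrix.SpecialLinearGroup (Fin 2) ℂ) : Prop :=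
  ∀ i, ∀ g ∈ D.peripheral i, (ρ g : Matrix (Fin 2) (Fin 2) ℂ).trace = 2

end KnotDiagram

/-- The projection from `SL(2, ℂ)` to `PSL(2, ℂ)`. -/
def projSL : Matrix.SpecialLinearGroup (Fin 2) ℂ →* Matrix.ProjectiveSpecialLinearGroup (Fin 2) ℂ :=
  QuotientGroup.mk' _

namespace KnotDiagram

variable {N : ℕ} [NeZero N]

open Classical in
/-- The obstruction class of a `PSL(2, ℂ)`-representation `ρ` of a knot group, as an element of
`{1, -1}`: it is trivial exactly if `ρ` lifts to a boundary-unipotent `SL(2, ℂ)`-representation. -/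
noncomputable def obstructionClass (D : KnotDiagram N)
    (ρ : D.knotGroup →* Matrix.ProjectiveSpecialLinearGroup (Fin 2) ℂ) : ℤˣ :=
  if ∃ τ : D.knotGroup →* Matrix.SpecialLinearGroup (Fin 2) ℂ,
      projSL.comp τ = ρ ∧ D.IsBoundaryUnipotent τ then 1 else -1

/-- The vectors `a` form an arc-coloring of sign-type `ε`: `ε c • a j = a i ▷ a k` at each positive
and `ε c • a j = a i ◁ a k` at each negative crossing `c`, with under-strands `i = c` (incoming),
`j = c + 1` (outgoing) and over-strand `k`. -/
def IsArcColoring (D : KnotDiagram N) (ε : Fin N → ℤˣ) (a : Fin N → Fin 2 → ℂ) : Prop :=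
  ∀ c, ((ε c : ℤ) : ℂ) • a (c + 1) =
    if D.sign c = 1 then qr (a c) (a (D.overArc c)) else ql (a c) (a (D.overArc c))

theorem IsArcColoring.lift_relator {D : KnotDiagram N} {ε : Fin N → ℤˣ} {a : Fin N → Fin 2 → ℂ}
    (h : D.IsArcColoring ε a) :
    ∀ r ∈ Set.range D.relator, FreeGroup.lift (fun i => quandleMap (a i)) r = 1 := by
  rintro _ ⟨c, rfl⟩
  have hc := congrArg quandleMap (h c)
  rw [quandleMap_sign_smul] at hc
  unfold relator
  split_ifs at hc ⊢ with hs
  · rw [qr, quandleMap_mulVec] at hc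
    simp only [map_mul, map_inv, FreeGroup.lift_apply_of, hc]
    group
  · rw [ql, quandleMap_mulVec] at hc
    simp only [map_mul, map_inv, FreeGroup.lift_apply_of, hc]
    group

/-- The representation associated with an arc-coloring `a`: it sends the meridian of arc `i` to
the image of `a i` under the parabolic quandle map. -/
def IsArcColoring.rep {D : KnotDiagram N} {ε : Fin N → ℤˣ} {a : Fin N → Fin 2 → ℂ}
    (h : D.IsArcColoring ε a) : D.knotGroup →* Matrix.SpecialLinearGroup (Fin 2) ℂ :=
  PresentedGroup.toGroup h.lift_relator

end KnotDiagram

/-!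
Write `E = ∏ c, ε c`.  At each crossing the coloring condition says that `M(a_k) ^ σ` carries
`a (c + 1)` to `ε c • a c`.  Composing these relations once around the knot shows that `a i` is an
eigenvector of the blackboard longitude at `i` with eigenvalue `E` (`rep_blackboardLongitude_mulVec`),
and since `M(a i)` fixes `a i`, the same holds for every framing.  If one `a i` vanishes, all do, and
the representation is trivial; otherwise a determinant-one matrix with eigenvalue `E = ±1` has trace
`2 * E` (`trace_eq_two_mul_of_mulVec_eq_smul`).

A lift `τ` of the projectivized representation differs from it by a central factor on each
meridian.  The Wirtinger relations force this factor to be the same on all arcs, so it cancels on the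
longitude with framing `0`, whose exponent sum vanishes (`map_longitude_zero_eq_of_projSL_eq`).
Hence for `E = -1` no lift is boundary-unipotent, while for `E = 1` the whole peripheral subgroup at
`i` fixes the nonzero vector `a i`.
-/

/-! ### Matrices of determinant one acting on vectors -/

section LinearAlgebra

/-- A matrix of determinant one with an eigenvalue `e = ±1` has `e` as a double eigenvalue. -/
theorem trace_eq_two_mul_of_mulVec_eq_smul (A : Matrix.SpecialLinearGroup (Fin 2) ℂ)
    {v : Fin 2 → ℂ} (hv : v ≠ 0) (e : ℤˣ)
    (h : (A : Matrix (Fin 2) (Fin 2) ℂ) *ᵥ v = ((e : ℤ) : ℂ) • v) :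
    (A : Matrix (Fin 2) (Fin 2) ℂ).trace = 2 * ((e : ℤ) : ℂ) := by
  have hA : A 0 0 * A 1 1 - A 0 1 * A 1 0 = 1 := by
    rw [← det_fin_two]; exact A.det_coe
  have he : ((e : ℤ) : ℂ) * ((e : ℤ) : ℂ) = 1 := by
    rcases Int.units_eq_one_or e with rfl | rfl <;> simp
  have h0 := congrFun h 0
  have h1 := congrFun h 1
  simp only [Matrix.mulVec, dotProduct, Fin.sum_univ_two, Pi.smul_apply, smul_eq_mul] at h0 h1
  rw [trace_fin_two]
  generalize ((e : ℤ) : ℂ) = s at *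
  -- Both coordinates of `v` are killed by the characteristic polynomial of `A` at `s`.
  have k0 : (2 * s - (A 0 0 + A 1 1)) * v 0 = 0 := by
    linear_combination s * (A 1 1 - s) * h0 - s * A 0 1 * h1 - s * v 0 * hA
      + (A 0 0 * v 0 + A 1 1 * v 0 - s * v 0) * he
  have k1 : (2 * s - (A 0 0 + A 1 1)) * v 1 = 0 := by
    linear_combination s * (A 0 0 - s) * h1 - s * A 1 0 * h0 - s * v 1 * hA
      + (A 0 0 * v 1 + A 1 1 * v 1 - s * v 1) * he
  by_contra hne
  have hs : 2 * s - (A 0 0 + A 1 1) ≠ 0 := fun hs => hne (sub_eq_zero.mp hs).symm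
  refine hv (funext fun j => ?_)
  fin_cases j
  · exact (mul_eq_zero.mp k0).resolve_left hs
  · exact (mul_eq_zero.mp k1).resolve_left hs

theorem coe_mul_mulVec (A B : Matrix.SpecialLinearGroup (Fin 2) ℂ) (v : Fin 2 → ℂ) :
    ((A * B : Matrix.SpecialLinearGroup (Fin 2) ℂ) : Matrix (Fin 2) (Fin 2) ℂ) *ᵥ v =
      (A : Matrix (Fin 2) (Fin 2) ℂ) *ᵥ ((B : Matrix (Fin 2) (Fin 2) ℂ) *ᵥ v) :=
  (mulVec_mulVec v (A : Matrix (Fin 2) (Fin 2) ℂ) (B : Matrix (Fin 2) (Fin 2) ℂ)).symm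

theorem inv_mulVec_eq_of_mulVec_eq {A : Matrix.SpecialLinearGroup (Fin 2) ℂ} {v w : Fin 2 → ℂ}
    (h : (A : Matrix (Fin 2) (Fin 2) ℂ) *ᵥ v = w) :
    ((A⁻¹ : Matrix.SpecialLinearGroup (Fin 2) ℂ) : Matrix (Fin 2) (Fin 2) ℂ) *ᵥ w = v := by
  rw [← h, ← coe_mul_mulVec, inv_mul_cancel]
  exact one_mulVec v

theorem quandleMap_mulVec_self (v : Fin 2 → ℂ) :
    (quandleMap v : Matrix (Fin 2) (Fin 2) ℂ) *ᵥ v = v := by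
  ext j
  fin_cases j <;> simp [quandleMap, Matrix.mulVec, dotProduct, Fin.sum_univ_two] <;> ring

/-- The vectors fixed by `A` are fixed by the subgroup it generates. -/
theorem zpow_mulVec_eq_self {A : Matrix.SpecialLinearGroup (Fin 2) ℂ} {v : Fin 2 → ℂ}
    (h : (A : Matrix (Fin 2) (Fin 2) ℂ) *ᵥ v = v) (n : ℤ) :
    ((A ^ n : Matrix.SpecialLinearGroup (Fin 2) ℂ) : Matrix (Fin 2) (Fin 2) ℂ) *ᵥ v = v := by
  induction n with
  | zero => simp
  | succ n ih => rw [_root_.zpow_add_one, coe_mul_mulVec, h, ih]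
  | pred n ih =>
    rw [_root_.zpow_sub_one, coe_mul_mulVec, inv_mulVec_eq_of_mulVec_eq h, ih]

theorem quandleMap_zero : quandleMap 0 = 1 := by
  ext i j
  fin_cases i <;> fin_cases j <;> simp [quandleMap]

end LinearAlgebra

/-! ### Central factors in products and cyclic induction -/

section Group

/-- Central factors can be collected from a product of powers. -/
theorem List.prod_ofFn_mul_zpow_of_mem_center {G : Type*} [Group G] {z : G}
    (hz : z ∈ Subgroup.center G) {n : ℕ} (g : Fin n → G) (e : Fin n → ℤ) :
    (List.ofFn fun t => (z * g t) ^ e t).prod =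
      z ^ (∑ t, e t) * (List.ofFn fun t => g t ^ e t).prod := by
  induction n with
  | zero => simp
  | succ n ih =>
    have hc : ∀ (x : G) (k : ℤ), x * z ^ k = z ^ k * x := fun x k =>
      Subgroup.mem_center_iff.mp (zpow_mem hz k) x
    rw [List.ofFn_succ, List.ofFn_succ, List.prod_cons, List.prod_cons, Fin.sum_univ_succ,
      ih, (show Commute z (g 0) from (Subgroup.mem_center_iff.mp hz (g 0)).symm).mul_zpow, _root_.zpow_add,
      mul_assoc, mul_assoc, ← mul_assoc (g 0 ^ e 0), hc, mul_assoc]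

end Group

open scoped Fin.CommRing in
/-- A property that passes from `i` to `i + 1` holds everywhere on the cyclic index set `Fin N`
once it holds somewhere. -/
theorem Fin.forall_of_add_one {N : ℕ} [NeZero N] {p : Fin N → Prop} (i : Fin N) (hi : p i)
    (h : ∀ c, p c → p (c + 1)) (j : Fin N) : p j := by
  have key : ∀ n : ℕ, p (i + (n : Fin N)) := by
    intro n
    induction n with
    | zero => simpa using hi
    | succ n ih =>
      rw [Nat.cast_succ, ← add_assoc]
      exact h _ ih
  simpa using key (j - i : Fin N).val

/-! ### Longitudes of colored diagrams and their lifts -/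

namespace KnotDiagram

variable {N : ℕ} [NeZero N]

theorem meridian_add_one (D : KnotDiagram N) (c : Fin N) :
    D.meridian (c + 1) = (D.meridian (D.overArc c) ^ (D.sign c : ℤ))⁻¹ * D.meridian c *
      D.meridian (D.overArc c) ^ (D.sign c : ℤ) := by
  have h : PresentedGroup.mk (Set.range D.relator) (D.relator c) = 1 :=
    PresentedGroup.one_of_mem ⟨c, rfl⟩
  rcases Int.units_eq_one_or (D.sign c) with hs | hs
  · rw [relator, if_pos hs] at h
    simp only [map_mul, map_inv, mul_assoc, inv_mul_eq_one] at h
    rw [hs, Units.val_one, zpow_one, mul_assoc]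
    exact h
  · rw [relator, if_neg (by rw [hs]; decide)] at h
    simp only [map_mul, map_inv, mul_assoc, inv_mul_eq_one] at h
    rw [hs, Units.val_neg, Units.val_one, _root_.zpow_neg_one, inv_inv, mul_assoc]
    exact h

section Coloring

variable {D : KnotDiagram N} {ε : Fin N → ℤˣ} {a : Fin N → Fin 2 → ℂ}

theorem IsArcColoring.rep_meridian (ha : D.IsArcColoring ε a) (i : Fin N) :
    ha.rep (D.meridian i) = quandleMap (a i) :=
  PresentedGroup.toGroup.of ha.lift_relator

/-- The coloring condition at both signs of a crossing, solved for the incoming vector. -/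
theorem IsArcColoring.zpow_mulVec (ha : D.IsArcColoring ε a) (c : Fin N) :
    ((quandleMap (a (D.overArc c)) ^ (D.sign c : ℤ) : Matrix.SpecialLinearGroup (Fin 2) ℂ) :
      Matrix (Fin 2) (Fin 2) ℂ) *ᵥ a (c + 1) = ((ε c : ℤ) : ℂ) • a c := by
  have he : ((ε c : ℤ) : ℂ) * ((ε c : ℤ) : ℂ) = 1 := by
    rcases Int.units_eq_one_or (ε c) with h | h <;> simp [h]
  have h : a (c + 1) = ((ε c : ℤ) : ℂ) • (((ε c : ℤ) : ℂ) • a (c + 1)) := by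
    rw [smul_smul, he, one_smul]
  rw [h, ha c, mulVec_smul]
  congr 1
  rcases Int.units_eq_one_or (D.sign c) with hs | hs
  · rw [if_pos hs, hs, Units.val_one, zpow_one, qr, ← coe_mul_mulVec, mul_inv_cancel]
    exact one_mulVec (a c)
  · rw [if_neg (by rw [hs]; decide), hs, Units.val_neg, Units.val_one, _root_.zpow_neg_one, ql]
    exact inv_mulVec_eq_of_mulVec_eq rfl

open scoped Fin.CommRing in
/-- The initial segments of the blackboard longitude at `i` transport the colors back to `a i`, up
to the product of the signs `ε` met on the way. -/
theorem IsArcColoring.prod_ofFn_mulVec (ha : D.IsArcColoring ε a) (i : Fin N) (n : ℕ) :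
    (((List.ofFn fun t : Fin n => quandleMap (a (D.overArc (i + ((t : ℕ) : Fin N)))) ^
      (D.sign (i + ((t : ℕ) : Fin N)) : ℤ)).prod : Matrix.SpecialLinearGroup (Fin 2) ℂ) :
        Matrix (Fin 2) (Fin 2) ℂ) *ᵥ a (i + (n : Fin N)) =
      (((∏ t : Fin n, ε (i + ((t : ℕ) : Fin N)) : ℤˣ) : ℤ) : ℂ) • a i := by
  induction n with
  | zero => simp
  | succ n ih =>
    rw [List.ofFn_succ', List.concat_eq_append, List.prod_append, List.prod_singleton,
      coe_mul_mulVec, Nat.cast_succ, ← add_assoc]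
    simp only [Fin.val_castSucc, Fin.val_last]
    rw [ha.zpow_mulVec, mulVec_smul, ih, smul_smul, Fin.prod_univ_castSucc]
    simp only [Fin.val_castSucc, Fin.val_last]
    push_cast
    rw [mul_comm]

open scoped Fin.CommRing in
/-- The color `a i` is an eigenvector of the blackboard longitude based at `i`. -/
theorem IsArcColoring.rep_blackboardLongitude_mulVec (ha : D.IsArcColoring ε a) (i : Fin N) :
    (ha.rep (D.blackboardLongitude i) : Matrix (Fin 2) (Fin 2) ℂ) *ᵥ a i =
      (((∏ c, ε c : ℤˣ) : ℤ) : ℂ) • a i := by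
  have h := ha.prod_ofFn_mulVec i N
  have hprod : ∏ t : Fin N, ε (i + t) = ∏ c, ε c :=
    Fintype.prod_equiv (Equiv.addLeft i) _ _ fun _ => rfl
  simp only [Fin.cast_val_eq_self, Fin.natCast_self, add_zero] at h
  rw [hprod] at h
  rw [← h, blackboardLongitude, map_list_prod, List.map_ofFn]
  simp only [Function.comp_def, map_zpow, ha.rep_meridian]

theorem IsArcColoring.rep_meridian_mulVec (ha : D.IsArcColoring ε a) (i : Fin N) :
    (ha.rep (D.meridian i) : Matrix (Fin 2) (Fin 2) ℂ) *ᵥ a i = a i := by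
  rw [ha.rep_meridian, quandleMap_mulVec_self]

theorem IsArcColoring.rep_longitude_mulVec (ha : D.IsArcColoring ε a) (i : Fin N) (f : ℤ) :
    (ha.rep (D.longitude i f) : Matrix (Fin 2) (Fin 2) ℂ) *ᵥ a i =
      (((∏ c, ε c : ℤˣ) : ℤ) : ℂ) • a i := by
  rw [longitude, map_mul, map_zpow, coe_mul_mulVec,
    zpow_mulVec_eq_self (ha.rep_meridian_mulVec i), ha.rep_blackboardLongitude_mulVec]

/-- If one color vanishes, then so do all of them, and every meridian acts trivially. -/
theorem IsArcColoring.ne_zero_of_rep_ne_one (ha : D.IsArcColoring ε a) (hne : ha.rep ≠ 1)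
    (i : Fin N) : a i ≠ 0 := by
  intro hi
  have hall : ∀ j, a j = 0 := Fin.forall_of_add_one i hi fun c hc => by
    have h := inv_mulVec_eq_of_mulVec_eq (ha.zpow_mulVec c)
    rwa [hc, smul_zero, mulVec_zero, eq_comm] at h
  refine hne (PresentedGroup.ext fun j => ?_)
  exact (ha.rep_meridian j).trans (by rw [hall j, quandleMap_zero]; rfl)

theorem IsArcColoring.trace_rep_longitude (ha : D.IsArcColoring ε a) (hne : ha.rep ≠ 1)
    (i : Fin N) (f : ℤ) : (ha.rep (D.longitude i f) : Matrix (Fin 2) (Fin 2) ℂ).trace =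
      2 * (((∏ c, ε c : ℤˣ) : ℤ) : ℂ) :=
  trace_eq_two_mul_of_mulVec_eq_smul _ (ha.ne_zero_of_rep_ne_one hne i) _
    (ha.rep_longitude_mulVec i f)

/-- If the total sign is `1`, the peripheral subgroup at `i` fixes the nonzero vector `a i`. -/
theorem IsArcColoring.isBoundaryUnipotent_rep (ha : D.IsArcColoring ε a) (hne : ha.rep ≠ 1)
    (hε : ∏ c, ε c = 1) : D.IsBoundaryUnipotent ha.rep := by
  intro i g hg
  have hfix : (ha.rep g : Matrix (Fin 2) (Fin 2) ℂ) *ᵥ a i = a i := by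
    induction hg using Subgroup.closure_induction with
    | mem x hx =>
      rcases hx with rfl | rfl
      · exact ha.rep_meridian_mulVec i
      · simpa [hε] using ha.rep_longitude_mulVec i 0
    | one => simp
    | mul x y _ _ hx hy => rw [map_mul, coe_mul_mulVec, hy, hx]
    | inv x _ hx =>
      rw [map_inv]
      exact inv_mulVec_eq_of_mulVec_eq hx
  simpa using trace_eq_two_mul_of_mulVec_eq_smul _ (ha.ne_zero_of_rep_ne_one hne i) 1
    (by simpa using hfix)

end Coloring

/-- Two representations which agree in `PSL(2, ℂ)` agree on the longitudes with framing `0`. -/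
theorem map_longitude_zero_eq_of_projSL_eq (D : KnotDiagram N)
    {τ ρ : D.knotGroup →* Matrix.SpecialLinearGroup (Fin 2) ℂ}
    (h : projSL.comp τ = projSL.comp ρ) (i : Fin N) :
    τ (D.longitude i 0) = ρ (D.longitude i 0) := by
  obtain ⟨z, hz, hzi⟩ : ∃ z ∈ Subgroup.center (Matrix.SpecialLinearGroup (Fin 2) ℂ),
      τ (D.meridian i) = z * ρ (D.meridian i) := by
    have hi : projSL (ρ (D.meridian i)) = projSL (τ (D.meridian i)) :=
      (DFunLike.congr_fun h (D.meridian i)).symm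
    have hm : (ρ (D.meridian i))⁻¹ * τ (D.meridian i) ∈ Subgroup.center _ := QuotientGroup.eq.mp hi
    exact ⟨_, hm, by rw [← Subgroup.mem_center_iff.mp hm, mul_inv_cancel_left]⟩
  -- The over-strand only matters up to a central factor, so `z` propagates along the arcs.
  have hall : ∀ j, τ (D.meridian j) = z * ρ (D.meridian j) :=
    Fin.forall_of_add_one i hzi fun c hc => by
      set w := D.meridian (D.overArc c) ^ (D.sign c : ℤ) with hw
      have hcen : (ρ w)⁻¹ * τ w ∈ Subgroup.center _ :=
        QuotientGroup.eq.mp (DFunLike.congr_fun h w).symm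
      have hzc := Subgroup.mem_center_iff.mp hz
      have hcc := Subgroup.mem_center_iff.mp hcen
      have hτ : τ w = ρ w * ((ρ w)⁻¹ * τ w) := (mul_inv_cancel_left _ _).symm
      generalize (ρ w)⁻¹ * τ w = u at hτ hcc
      rw [D.meridian_add_one, ← hw]
      simp only [map_mul, map_inv]
      rw [hτ, hc]
      calc (ρ w * u)⁻¹ * (z * ρ (D.meridian c)) * (ρ w * u)
          = u⁻¹ * ((ρ w)⁻¹ * z * ρ (D.meridian c) * ρ w * u) := by group
        _ = u⁻¹ * (u * ((ρ w)⁻¹ * z * ρ (D.meridian c) * ρ w)) := by rw [hcc]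
        _ = (ρ w)⁻¹ * z * ρ (D.meridian c) * ρ w := inv_mul_cancel_left _ _
        _ = z * ((ρ w)⁻¹ * ρ (D.meridian c) * ρ w) := by rw [hzc]; group
  have hsum : ∑ t : Fin N, (D.sign (i + t) : ℤ) = D.writhe :=
    Fintype.sum_equiv (Equiv.addLeft i) _ _ fun _ => rfl
  simp only [longitude, blackboardLongitude, map_mul, map_list_prod, List.map_ofFn,
    Function.comp_def, map_zpow, hall]
  -- The exponents `writhe` and `0 - writhe` of `z` add up to zero.
  rw [List.prod_ofFn_mul_zpow_of_mem_center hz, hsum,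
    (show Commute z _ from (Subgroup.mem_center_iff.mp hz _).symm).mul_zpow, zero_sub, _root_.zpow_neg z,
    mul_assoc, ← mul_assoc _ (z ^ D.writhe)⁻¹,
    Subgroup.mem_center_iff.mp (inv_mem (zpow_mem hz D.writhe)), mul_assoc, mul_inv_cancel_left]

end KnotDiagram

theorem theorem3 {N : ℕ} [NeZero N] (D : KnotDiagram N) (ε : Fin N → ℤˣ)
    (a : Fin N → Fin 2 → ℂ) (ha : D.IsArcColoring ε a) (hne : ha.rep ≠ 1) :
    D.obstructionClass (projSL.comp ha.rep) = ∏ c, ε c ∧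
    (∀ (i : Fin N) (f : ℤ),
      (ha.rep (D.longitude i f) : Matrix (Fin 2) (Fin 2) ℂ).trace = 2 * (((∏ c, ε c : ℤˣ) : ℤ) : ℂ)) ∧
    (∀ τ : D.knotGroup →* Matrix.SpecialLinearGroup (Fin 2) ℂ,
      projSL.comp τ = projSL.comp ha.rep → ∀ i : Fin N,
        (τ (D.longitude i 0) : Matrix (Fin 2) (Fin 2) ℂ).trace = 2 * (((∏ c, ε c : ℤˣ) : ℤ) : ℂ)) ∧
    (D.IsBoundaryUnipotent ha.rep ↔ ∏ c, ε c = 1) := by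
  have hlift : ∀ τ : D.knotGroup →* Matrix.SpecialLinearGroup (Fin 2) ℂ,
      projSL.comp τ = projSL.comp ha.rep → ∀ i : Fin N,
        (τ (D.longitude i 0) : Matrix (Fin 2) (Fin 2) ℂ).trace =
          2 * (((∏ c, ε c : ℤˣ) : ℤ) : ℂ) := fun τ hτ i => by
    rw [D.map_longitude_zero_eq_of_projSL_eq hτ, ha.trace_rep_longitude hne]
  have hone : ∀ τ : D.knotGroup →* Matrix.SpecialLinearGroup (Fin 2) ℂ,
      projSL.comp τ = projSL.comp ha.rep → D.IsBoundaryUnipotent τ → ∏ c, ε c = 1 := by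
    intro τ hτ hu
    have htr := hu 0 (D.longitude 0 0) (Subgroup.subset_closure (by simp))
    rw [hlift τ hτ 0] at htr
    rcases Int.units_eq_one_or (∏ c, ε c) with h | h
    · exact h
    · rw [h] at htr
      norm_num at htr
  refine ⟨?_, ha.trace_rep_longitude hne, hlift, hone _ rfl, ha.isBoundaryUnipotent_rep hne⟩
  unfold KnotDiagram.obstructionClass
  split_ifs with h
  · obtain ⟨τ, hτ, hu⟩ := h
    exact (hone τ hτ hu).symm
  · refine ((Int.units_eq_one_or _).resolve_left fun hε => h ?_).symm
    exact ⟨ha.rep, rfl, ha.isBoundaryUnipotent_rep hne hε⟩
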